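/- Let $p$ be a prime, let $q=p^e$ with $e\ge 1$, and let $m,k\ge 1$. Let $f\in\mathbb{F}_{q^m}[x_1,\ldots,x_k]$ be a polynomial of total degree $d\ge 1$, and let $N(f=y^q-y)$ denote the number of $(x_1,\ldots,x_k,y)\in\mathbb{F}_{q^m}^{k+1}$ with $f(x_1,\ldots,x_k)=y^q-y$. For $a\in\mathbb{N}$ let $S_p(a)$ be the sum of the base-$p$ digits of $a$, and put \[ W_p(d,\mathbb{F}_{q^m}^k)=\max\Bigl\{\sum_{i=1}^k S_p(t_i) : (t_1,\ldots,t_k)\in\{0,1,\ldots,q^m-1\}^k,\ t_1+\cdots+t_k\le d\Bigr\}. \] Then \[ \nu_p\bigl(N(f=y^q-y)\bigr)\ \ge\ \left\lceil \frac{emk}{W_p(d,\mathbb{F}_{q^m}^k)}\right\rceil , \] where $\nu_p$ is the $p$-adic valuation, with $\nu_p(0)=\infty$. -/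

import Mathlib

namespace ArtinSchreierCount

/-- The sum `S_p(a)` of the base-`p` digits of `a`. -/
def digitSum (p a : ℕ) : ℕ := (Nat.digits p a).sum

/-- `maxDigitSum p Q k d` is the maximum of `S_p(t₁) + ⋯ + S_p(t_k)` over all tuples
`t ∈ [0, Q - 1]^k` with `t₁ + ⋯ + t_k ≤ d`. The set of tuples is finite and, for `Q ≥ 1`,
contains `t = 0`, so the supremum is a maximum. -/
def maxDigitSum (p Q k d : ℕ) : ℕ :=
  ((Fintype.piFinset fun _ : Fin k => Finset.range Q).filter fun t => ∑ i, t i ≤ d).sup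
    fun t => ∑ i, digitSum p (t i)

/-- The number of solutions `(x₁, …, x_k, y)` in `K^(k+1)` of `f(x₁, …, x_k) = y ^ q - y`. -/
noncomputable def solutionCount {K : Type*} [Field K] {k : ℕ}
    (f : MvPolynomial (Fin k) K) (q : ℕ) : ℕ :=
  Nat.card {z : (Fin k → K) × K // MvPolynomial.eval z.1 f = z.2 ^ q - z.2}

end ArtinSchreierCount

/-!
Let `L` be any additive endomorphism of `K`, such as `y ↦ y ^ q - y`, and let `N` be the number of
solutions of `f(x) = L(y)`. Orthogonality for a primitive additive character `ψ` of `K` with values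
in `ℤ[ζ_p]` writes `N` as the sum of the character sums `∑ x, ψ (b * f x)` over the `b` for which
`ψ (b * L y) = 1` for all `y`, so it suffices to bound the valuations of these sums at the prime
`π = ζ_p - 1`, where `π ^ (p - 1)` is associated to `p` and `ψ ≡ 1` modulo `π`.

Frobenius is additive, so a monomial `x ^ t` behaves like a function of degree `∑ S_p(t_i)`: more
forward differences than that kill it. Hence `b * f` has functional degree at most `W`, and after
rescaling `π` to have valuation `W` the `j`-fold differences of `ψ ∘ (b * f)` have valuation at
least `j`. Summing a function over a line `x, x + w, …, x + (p - 1) w` yields its `(p - 1)`-st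
difference plus multiples of `p`, so each of the `nk` directions of `K ^ k` over `𝔽_p`, where
`#K = p ^ n`, raises the valuation by `p - 1`. Hence `nk (p - 1) ≤ W v_π(N) = W (p - 1) ν_p(N)`.
-/

namespace ArtinSchreierCount

open Finset
open scoped fwdDiff

section Differences

variable {G B C : Type*} [AddCommMonoid G] [AddCommGroup B] [AddCommGroup C]

theorem foldl_fwdDiff_add (vs : List G) (F F' : G → B) :
    vs.foldl (fun f v => Δ_[v] f) (F + F') =
      vs.foldl (fun f v => Δ_[v] f) F + vs.foldl (fun f v => Δ_[v] f) F' := by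
  induction vs generalizing F F' with
  | nil => rfl
  | cons v vs ih => simp only [List.foldl_cons, fwdDiff_add, ih]

theorem foldl_fwdDiff_neg (vs : List G) (F : G → B) :
    vs.foldl (fun f v => Δ_[v] f) (-F) = -vs.foldl (fun f v => Δ_[v] f) F := by
  induction vs generalizing F with
  | nil => rfl
  | cons v vs ih =>
    have hneg : Δ_[v] (-F) = -Δ_[v] F := by simpa using fwdDiff_const_smul v (-1 : ℤ) F
    simp only [List.foldl_cons, hneg, ih]

theorem foldl_fwdDiff_zero (vs : List G) :
    vs.foldl (fun f v => Δ_[v] f) (0 : G → B) = 0 := by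
  simpa using foldl_fwdDiff_add vs (0 : G → B) 0

/-- The functions `F : G → B` all of whose `j`-fold forward differences, in arbitrary directions,
take values in `I j`. Bounds on the functional degree and lower bounds on valuations of differences
are both of this form, for different families `I`. -/
def differencesIn (I : ℕ → AddSubgroup B) : AddSubgroup (G → B) where
  carrier := {F | ∀ (vs : List G) (x : G), vs.foldl (fun f v => Δ_[v] f) F x ∈ I vs.length}
  zero_mem' vs x := by
    rw [foldl_fwdDiff_zero]
    exact zero_mem _
  add_mem' hF hF' vs x := by
    rw [foldl_fwdDiff_add]
    exact add_mem (hF vs x) (hF' vs x)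
  neg_mem' hF vs x := by
    rw [foldl_fwdDiff_neg]
    exact neg_mem (hF vs x)

variable {I J : ℕ → AddSubgroup B}

theorem mem_differencesIn_iff {F : G → B} :
    F ∈ differencesIn I ↔
      (∀ x, F x ∈ I 0) ∧ ∀ v, Δ_[v] F ∈ differencesIn fun j => I (j + 1) := by
  refine ⟨fun hF => ⟨hF [], fun v vs => hF (v :: vs)⟩, fun ⟨hF, hΔ⟩ vs => ?_⟩
  cases vs with
  | nil => exact hF
  | cons v vs => exact hΔ v vs

theorem apply_mem_of_mem_differencesIn {F : G → B} (hF : F ∈ differencesIn I) (x : G) :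
    F x ∈ I 0 :=
  (mem_differencesIn_iff.1 hF).1 x

theorem fwdDiff_mem_differencesIn {F : G → B} (hF : F ∈ differencesIn I) (v : G) :
    Δ_[v] F ∈ differencesIn fun j => I (j + 1) :=
  (mem_differencesIn_iff.1 hF).2 v

theorem fwdDiff_iter_mem_differencesIn {F : G → B} (hF : F ∈ differencesIn I) (v : G) (n : ℕ) :
    (fwdDiff v)^[n] F ∈ differencesIn fun j => I (j + n) := by
  induction n with
  | zero => exact hF
  | succ n ih =>
    rw [Function.iterate_succ_apply']
    simpa only [add_right_comm, add_assoc] using fwdDiff_mem_differencesIn ih v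

theorem differencesIn_mono (hIJ : I ≤ J) :
    (differencesIn I : AddSubgroup (G → B)) ≤ differencesIn J :=
  fun _ hF vs x => hIJ _ (hF vs x)

theorem const_mem_differencesIn {c : B} (hc : c ∈ I 0) :
    (fun _ : G => c) ∈ differencesIn I := by
  refine mem_differencesIn_iff.2 ⟨fun _ => hc, fun v => ?_⟩
  rw [fwdDiff_const]
  exact zero_mem _

theorem addMonoidHom_comp_mem_differencesIn {J : ℕ → AddSubgroup C} {F : G → B}
    (hF : F ∈ differencesIn I) (φ : B →+ C) (hφ : ∀ j, ∀ b ∈ I j, φ b ∈ J j) :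
    φ ∘ F ∈ differencesIn J := by
  intro vs x
  induction vs generalizing I J F with
  | nil => exact hφ 0 _ (hF [] x)
  | cons v vs ih =>
    have hcomp : Δ_[v] (φ ∘ F) = φ ∘ Δ_[v] F := by ext; simp [fwdDiff]
    rw [List.foldl_cons, hcomp]
    exact ih (fwdDiff_mem_differencesIn hF v) fun j => hφ (j + 1)

theorem sum_range_shift_eq_sum_choose_smul_fwdDiff_iter (F : G → B) (w x : G) (n : ℕ) :
    ∑ j ∈ range n, F (x + j • w) = ∑ i ∈ range n, n.choose (i + 1) • (fwdDiff w)^[i] F x := by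
  induction n with
  | zero => simp
  | succ n ih =>
    have hext : ∑ i ∈ range n, n.choose (i + 1) • (fwdDiff w)^[i] F x =
        ∑ i ∈ range (n + 1), n.choose (i + 1) • (fwdDiff w)^[i] F x := by
      simp [sum_range_succ _ n]
    rw [sum_range_succ, ih, hext, shift_eq_sum_fwdDiff_iter w F n x, ← sum_add_distrib]
    exact sum_congr rfl fun i _ => by rw [Nat.choose_succ_succ, add_comm, add_smul]

theorem fwdDiff_mul {S : Type*} [Ring S] (v : G) (F F' : G → S) :
    Δ_[v] (F * F') = Δ_[v] F * F' + F * Δ_[v] F' + Δ_[v] F * Δ_[v] F' :=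
  fwdDiff_smul v F F'

theorem mul_mem_differencesIn {S : Type*} [Ring S] {I J K : ℕ → AddSubgroup S} (hK : Antitone K)
    (hIJK : ∀ i j, ∀ a ∈ I i, ∀ b ∈ J j, a * b ∈ K (i + j)) {F F' : G → S}
    (hF : F ∈ differencesIn I) (hF' : F' ∈ differencesIn J) : F * F' ∈ differencesIn K := by
  intro vs x
  induction vs generalizing I J K F F' with
  | nil => exact hIJK 0 0 _ (hF [] x) _ (hF' [] x)
  | cons v vs ih =>
    have hK' : Antitone fun j => K (j + 1) := fun _ _ h => hK (Nat.succ_le_succ h)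
    have hΔF := fwdDiff_mem_differencesIn hF v
    have hΔF' := fwdDiff_mem_differencesIn hF' v
    rw [List.foldl_cons, fwdDiff_mul, foldl_fwdDiff_add, foldl_fwdDiff_add]
    refine add_mem (add_mem (ih hK' ?_ hΔF hF') (ih hK' ?_ hF hΔF')) (ih hK' ?_ hΔF hΔF')
    · intro i j a ha b hb
      simpa only [add_right_comm] using hIJK (i + 1) j a ha b hb
    · intro i j a ha b hb
      exact hIJK i (j + 1) a ha b hb
    · intro i j a ha b hb
      exact hK (by omega) (hIJK (i + 1) (j + 1) a ha b hb)

end Differences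

section FunctionalDegree

variable {G B C : Type*} [AddCommMonoid G] [AddCommGroup B] [AddCommGroup C]

/-- The family of subgroups that is everything up to index `r` and trivial afterwards. -/
def degreeFiltration (B : Type*) [AddCommGroup B] (r j : ℕ) : AddSubgroup B :=
  if j ≤ r then ⊤ else ⊥

/-- `F` has functional degree at most `r`: its `j`-fold forward differences vanish for `j > r`. -/
def FunctionalDegreeLE (r : ℕ) (F : G → B) : Prop :=
  F ∈ differencesIn (degreeFiltration B r)

theorem degreeFiltration_zero_right (r : ℕ) : degreeFiltration B r 0 = ⊤ :=
  if_pos r.zero_le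

theorem degreeFiltration_succ_succ (r j : ℕ) :
    degreeFiltration B (r + 1) (j + 1) = degreeFiltration B r j := by
  simp only [degreeFiltration, add_le_add_iff_right]

theorem degreeFiltration_mono : Monotone (degreeFiltration B) := by
  intro r s hrs j
  simp only [degreeFiltration]
  split_ifs <;> first | exact le_rfl | exact bot_le | omega

theorem degreeFiltration_antitone (r : ℕ) : Antitone (degreeFiltration B r) := by
  intro i j hij
  simp only [degreeFiltration]
  split_ifs <;> first | exact le_rfl | exact bot_le | omega

theorem FunctionalDegreeLE.mono {r s : ℕ} (hrs : r ≤ s) {F : G → B}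
    (hF : FunctionalDegreeLE r F) : FunctionalDegreeLE s F :=
  differencesIn_mono (degreeFiltration_mono hrs) hF

theorem functionalDegreeLE_succ_iff {r : ℕ} {F : G → B} :
    FunctionalDegreeLE (r + 1) F ↔ ∀ v, FunctionalDegreeLE r (Δ_[v] F) := by
  simp [FunctionalDegreeLE, mem_differencesIn_iff (F := F), degreeFiltration_succ_succ,
    degreeFiltration_zero_right]

theorem FunctionalDegreeLE.eq_const {F : G → B} (hF : FunctionalDegreeLE 0 F) (x : G) :
    F x = F 0 := by
  have h : Δ_[x] F 0 ∈ degreeFiltration B 0 1 := hF [x] 0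
  simpa [degreeFiltration, fwdDiff, sub_eq_zero] using h

theorem functionalDegreeLE_const (r : ℕ) (c : B) : FunctionalDegreeLE r fun _ : G => c :=
  const_mem_differencesIn (degreeFiltration_zero_right (B := B) r ▸ AddSubgroup.mem_top c)

theorem functionalDegreeLE_addMonoidHom (φ : G →+ B) : FunctionalDegreeLE 1 φ := by
  refine functionalDegreeLE_succ_iff.2 fun v => ?_
  have hΔ : Δ_[v] φ = fun _ => φ v := by ext; simp [fwdDiff]
  rw [hΔ]
  exact functionalDegreeLE_const 0 _

theorem FunctionalDegreeLE.sum {ι : Type*} {s : Finset ι} {r : ℕ} {F : ι → G → B}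
    (hF : ∀ i ∈ s, FunctionalDegreeLE r (F i)) : FunctionalDegreeLE r (∑ i ∈ s, F i) :=
  sum_mem hF

theorem FunctionalDegreeLE.map {r : ℕ} {F : G → B} (hF : FunctionalDegreeLE r F) (φ : B →+ C) :
    FunctionalDegreeLE r (φ ∘ F) := by
  refine addMonoidHom_comp_mem_differencesIn hF φ fun j b hb => ?_
  by_cases hj : j ≤ r
  · simp [degreeFiltration, hj]
  · simp_all [degreeFiltration]

theorem FunctionalDegreeLE.mul {S : Type*} [Ring S] {r s : ℕ} {F F' : G → S}
    (hF : FunctionalDegreeLE r F) (hF' : FunctionalDegreeLE s F') :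
    FunctionalDegreeLE (r + s) (F * F') := by
  refine mul_mem_differencesIn (degreeFiltration_antitone _) (fun i j a ha b hb => ?_) hF hF'
  by_cases hij : i + j ≤ r + s
  · simp [degreeFiltration, hij]
  · rcases (by omega : ¬i ≤ r ∨ ¬j ≤ s) with hi | hj <;> simp_all [degreeFiltration]

theorem FunctionalDegreeLE.prod {S : Type*} [CommRing S] {ι : Type*} {s : Finset ι} {r : ι → ℕ}
    {F : ι → G → S} (hF : ∀ i ∈ s, FunctionalDegreeLE (r i) (F i)) :
    FunctionalDegreeLE (∑ i ∈ s, r i) (∏ i ∈ s, F i) := by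
  classical
  induction s using Finset.induction_on with
  | empty => exact functionalDegreeLE_const _ (1 : S)
  | insert a s ha ih =>
    rw [sum_insert ha, prod_insert ha]
    exact (hF a (mem_insert_self a s)).mul (ih fun i hi => hF i (mem_insert_of_mem hi))

theorem FunctionalDegreeLE.pow {S : Type*} [CommRing S] {r : ℕ} {F : G → S}
    (hF : FunctionalDegreeLE r F) (n : ℕ) : FunctionalDegreeLE (n * r) (F ^ n) := by
  simpa using FunctionalDegreeLE.prod (s := range n) fun _ _ => hF

/-- Frobenius is additive, so raising to the `p`-th power does not increase the functional degree
and only the digits of the exponent count. -/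
theorem FunctionalDegreeLE.pow_digitSum {S : Type*} [CommRing S] {p : ℕ} [Fact p.Prime] [CharP S p]
    {r : ℕ} {F : G → S} (hF : FunctionalDegreeLE r F) (t : ℕ) :
    FunctionalDegreeLE (digitSum p t * r) (F ^ t) := by
  have hp : 1 < p := (Fact.out : p.Prime).one_lt
  induction t using Nat.strong_induction_on with
  | _ t ih =>
    rcases Nat.eq_zero_or_pos t with rfl | ht
    · rw [pow_zero]
      exact functionalDegreeLE_const _ (1 : S)
    have hpow : F ^ t = F ^ (t % p) * (frobenius S p).toAddMonoidHom ∘ (F ^ (t / p)) := by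
      ext x
      simp [frobenius_def, ← pow_mul', ← pow_add, Nat.mod_add_div']
    have hdigits : digitSum p t = t % p + digitSum p (t / p) := by
      rw [digitSum, digitSum, Nat.digits_def' hp ht, List.sum_cons]
    rw [hpow, hdigits, add_mul]
    exact (hF.pow _).mul ((ih _ (Nat.div_lt_self ht hp)).map _)

end FunctionalDegree

section Polynomial

theorem exists_lt_natCard_pow_eq (K : Type*) [Field K] [Finite K] (t : ℕ) :
    ∃ s ≤ t, s < Nat.card K ∧ ∀ x : K, x ^ s = x ^ t := by
  have := Fintype.ofFinite K
  have hK : 1 < Nat.card K := Finite.one_lt_card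
  induction t using Nat.strong_induction_on with
  | _ t ih =>
    rcases Nat.lt_or_ge t (Nat.card K) with ht | ht
    · exact ⟨t, le_rfl, ht, fun _ => rfl⟩
    obtain ⟨s, hs, hsK, hpow⟩ := ih (t - Nat.card K + 1) (by omega)
    refine ⟨s, hs.trans (by omega), hsK, fun x => ?_⟩
    calc x ^ s = x ^ (t - Nat.card K) * x := by rw [hpow, pow_succ]
      _ = x ^ (t - Nat.card K) * x ^ Nat.card K := by
        rw [Nat.card_eq_fintype_card, FiniteField.pow_card]
      _ = x ^ t := by rw [← pow_add, Nat.sub_add_cancel ht]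

theorem functionalDegreeLE_monomial {S σ : Type*} [CommRing S] [Fintype σ] (p : ℕ) [Fact p.Prime]
    [CharP S p] (t : σ → ℕ) :
    FunctionalDegreeLE (∑ i, digitSum p (t i)) fun x : σ → S => ∏ i, x i ^ t i := by
  have h := FunctionalDegreeLE.prod (s := univ) fun i _ =>
    (functionalDegreeLE_addMonoidHom (Pi.evalAddMonoidHom (fun _ : σ => S) i)).pow_digitSum
      (p := p) (t i)
  convert h using 1
  · simp only [mul_one]
  · ext x
    simp

theorem sum_digitSum_le_maxDigitSum (p : ℕ) {Q k d : ℕ} {t : Fin k → ℕ} (ht : ∀ i, t i < Q)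
    (hd : ∑ i, t i ≤ d) : ∑ i, digitSum p (t i) ≤ maxDigitSum p Q k d :=
  le_sup (f := fun t : Fin k → ℕ => ∑ i, digitSum p (t i))
    (mem_filter.2 ⟨Fintype.mem_piFinset.2 fun i => mem_range.2 (ht i), hd⟩)

theorem maxDigitSum_pos {p Q k d : ℕ} (hp : 1 < p) (hQ : 1 < Q) (hk : 0 < k) (hd : 0 < d) :
    0 < maxDigitSum p Q k d := by
  let t : Fin k → ℕ := Pi.single ⟨0, hk⟩ 1
  have ht (i : Fin k) : t i < Q := by
    rcases eq_or_ne i ⟨0, hk⟩ with rfl | hi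
    · simpa [t] using hQ
    · simpa [t, hi] using Nat.zero_lt_of_lt hQ
  have hsum : ∑ i, digitSum p (t i) = 1 := by
    simp [t, digitSum, Pi.single_apply, apply_ite, Nat.digits_of_lt p 1 one_ne_zero hp]
  have hle : ∑ i, t i ≤ d := by simpa [t] using Nat.succ_le_of_lt hd
  exact Nat.one_pos.trans_le (hsum ▸ sum_digitSum_le_maxDigitSum p ht hle)

theorem functionalDegreeLE_eval {K : Type*} [Field K] [Finite K] (p : ℕ) [Fact p.Prime]
    [CharP K p] {k : ℕ} (f : MvPolynomial (Fin k) K) :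
    FunctionalDegreeLE (maxDigitSum p (Nat.card K) k f.totalDegree)
      fun x : Fin k → K => MvPolynomial.eval x f := by
  have heval : (fun x : Fin k → K => MvPolynomial.eval x f) =
      ∑ t ∈ f.support, AddMonoidHom.mulLeft (f.coeff t) ∘ fun x => ∏ i, x i ^ t i := by
    ext x
    simp [MvPolynomial.eval_eq', Finset.sum_apply]
  rw [heval]
  refine FunctionalDegreeLE.sum fun t ht => FunctionalDegreeLE.map ?_ _
  choose s hst hsK hpow using fun i => exists_lt_natCard_pow_eq K (t i)
  have hs : ∑ i, s i ≤ f.totalDegree := calc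
    ∑ i, s i ≤ ∑ i, t i := sum_le_sum fun i _ => hst i
    _ = t.sum fun _ n => n := (Finsupp.sum_fintype t (fun _ n => n) fun _ => rfl).symm
    _ ≤ f.totalDegree := MvPolynomial.le_totalDegree ht
  simpa only [hpow] using
    (functionalDegreeLE_monomial (S := K) p s).mono (sum_digitSum_le_maxDigitSum p hsK hs)

end Polynomial

section Valuation

variable {G R : Type*} [AddCommMonoid G] [CommRing R] (v : AddValuation R ℕ∞)

/-- The elements of valuation at least `n`, as an additive subgroup. -/
def valuationGE (n : ℕ) : AddSubgroup R where
  carrier := {a | n ≤ v a}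
  zero_mem' := by simp
  add_mem' ha hb := v.map_le_add ha hb
  neg_mem' {a} ha := by simpa using ha

variable {v}

theorem mem_valuationGE {n : ℕ} {a : R} : a ∈ valuationGE v n ↔ n ≤ v a :=
  Iff.rfl

theorem valuationGE_antitone : Antitone (valuationGE v) :=
  fun _ _ hmn _ ha => (Nat.cast_le.2 hmn).trans (mem_valuationGE.1 ha)

theorem valuationGE_zero : valuationGE v 0 = ⊤ :=
  top_le_iff.1 fun a _ => by simp [mem_valuationGE]

theorem mul_mem_valuationGE {m n : ℕ} {a b : R} (ha : a ∈ valuationGE v m)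
    (hb : b ∈ valuationGE v n) : a * b ∈ valuationGE v (m + n) := by
  rw [mem_valuationGE, v.map_mul, Nat.cast_add]
  exact add_le_add ha hb

variable (G v) in
/-- The functions `F` whose `j`-fold forward differences have valuation at least `b + j`. -/
def steepDifferences (b : ℕ) : AddSubgroup (G → R) :=
  differencesIn fun j => valuationGE v (b + j)

theorem steepDifferences_antitone : Antitone (steepDifferences G v) :=
  fun _ _ hbc => differencesIn_mono fun _ => valuationGE_antitone (by gcongr)

theorem const_mem_steepDifferences {b : ℕ} {c : R} (hc : b ≤ v c) :
    (fun _ => c) ∈ steepDifferences G v b :=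
  const_mem_differencesIn hc

theorem mul_mem_steepDifferences {b c : ℕ} {F F' : G → R} (hF : F ∈ steepDifferences G v b)
    (hF' : F' ∈ steepDifferences G v c) : F * F' ∈ steepDifferences G v (b + c) := by
  refine mul_mem_differencesIn (fun _ _ h => valuationGE_antitone (by gcongr)) ?_ hF hF'
  intro i j x hx y hy
  rw [add_add_add_comm]
  exact mul_mem_valuationGE hx hy

theorem fwdDiff_iter_mem_steepDifferences {b : ℕ} {F : G → R} (hF : F ∈ steepDifferences G v b)
    (w : G) (n : ℕ) : (fwdDiff w)^[n] F ∈ steepDifferences G v (b + n) := by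
  simpa only [steepDifferences, add_assoc, add_comm n] using fwdDiff_iter_mem_differencesIn hF w n

/-- Each difference of `F` reproduces `F` up to a factor of positive valuation, so the bound on the
valuation of the differences can be improved one level of differences at a time. -/
theorem mem_steepDifferences_zero_of_fwdDiff_eq_mul {F : G → R} {U : G → G → R}
    (hF : ∀ w, Δ_[w] F = F * U w) (hU : ∀ w, U w ∈ steepDifferences G v 1) :
    F ∈ steepDifferences G v 0 := by
  have htrunc (M : ℕ) : F ∈ differencesIn fun j => valuationGE v (min j M) := by
    induction M with
    | zero => exact fun vs x => by simp [valuationGE_zero]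
    | succ M ih =>
      refine mem_differencesIn_iff.2 ⟨fun x => by simp [valuationGE_zero], fun w => ?_⟩
      rw [hF w]
      refine mul_mem_differencesIn (fun i j hij => valuationGE_antitone (by omega)) ?_ ih (hU w)
      exact fun i j a ha b hb => valuationGE_antitone (by omega) (mul_mem_valuationGE ha hb)
  intro vs x
  simpa using htrunc vs.length vs x

theorem addChar_comp_sub_one_mem_steepDifferences {A : Type*} [AddCommGroup A] (ψ : AddChar A R)
    {b r : ℕ} (hψ : ∀ a, ((b + r : ℕ) : ℕ∞) ≤ v (ψ a - 1)) {h : G → A}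
    (hh : FunctionalDegreeLE r h) : (fun x => ψ (h x) - 1) ∈ steepDifferences G v b := by
  induction r generalizing b h with
  | zero =>
    simp only [hh.eq_const]
    exact const_mem_steepDifferences (hψ _)
  | succ r ih =>
    have hψ' (a : A) : ((b + 1 + r : ℕ) : ℕ∞) ≤ v (ψ a - 1) := by
      rw [add_right_comm, add_assoc]
      exact hψ a
    have hU (w : G) := ih hψ' (functionalDegreeLE_succ_iff.1 hh w)
    have hmul (w : G) : Δ_[w] (fun x => ψ (h x)) =
        (fun x => ψ (h x)) * fun x => ψ (Δ_[w] h x) - 1 := by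
      ext x
      have hshift : h (x + w) = h x + Δ_[w] h x := by simp [fwdDiff]
      rw [fwdDiff, hshift, ψ.map_add_eq_mul, Pi.mul_apply]
      ring
    have hF : (fun x => ψ (h x)) ∈ steepDifferences G v 0 :=
      mem_steepDifferences_zero_of_fwdDiff_eq_mul hmul fun w =>
        steepDifferences_antitone (by omega) (hU w)
    refine mem_differencesIn_iff.2
      ⟨fun x => (Nat.cast_le.2 (by omega)).trans (hψ (h x)), fun w => ?_⟩
    have hΔ : Δ_[w] (fun x => ψ (h x) - 1) =
        (fun x => ψ (h x)) * fun x => ψ (Δ_[w] h x) - 1 := by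
      rw [← hmul]
      ext x
      simp [fwdDiff]
    rw [hΔ]
    simpa only [steepDifferences, zero_add, add_assoc, add_comm 1] using
      mul_mem_steepDifferences hF (hU w)

theorem addChar_comp_mem_steepDifferences {A : Type*} [AddCommGroup A] (ψ : AddChar A R) {r : ℕ}
    (hψ : ∀ a, r ≤ v (ψ a - 1)) {h : G → A} (hh : FunctionalDegreeLE r h) :
    (fun x => ψ (h x)) ∈ steepDifferences G v 0 := by
  have hsub := addChar_comp_sub_one_mem_steepDifferences (b := 0) ψ (by simpa using hψ) hh
  have hone : (fun _ => 1) ∈ steepDifferences G v 0 := const_mem_steepDifferences (by simp)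
  simpa [Pi.add_def] using add_mem hsub hone

theorem sum_range_shift_mem_steepDifferences {p : ℕ} (hp : p.Prime)
    (hv : ((p - 1 : ℕ) : ℕ∞) ≤ v p) {b : ℕ} {F : G → R} (hF : F ∈ steepDifferences G v b) (w : G) :
    (fun x => ∑ j ∈ range p, F (x + j • w)) ∈ steepDifferences G v (b + (p - 1)) := by
  have hsum : (fun x => ∑ j ∈ range p, F (x + j • w)) =
      ∑ i ∈ range p, (fun _ => (p.choose (i + 1) : R)) * (fwdDiff w)^[i] F := by
    ext x
    simp [sum_range_shift_eq_sum_choose_smul_fwdDiff_iter, Finset.sum_apply]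
  rw [hsum]
  refine sum_mem fun i hi => ?_
  have hΔ := fwdDiff_iter_mem_steepDifferences hF w i
  rcases (Nat.succ_le_of_lt (mem_range.1 hi)).lt_or_eq with hlt | heq
  · obtain ⟨c, hc⟩ := hp.dvd_choose_self i.succ_ne_zero hlt
    have hchoose : ((p - 1 : ℕ) : ℕ∞) ≤ v (p.choose (i + 1) : R) := by
      rw [hc, Nat.cast_mul, v.map_mul]
      exact hv.trans le_self_add
    exact steepDifferences_antitone (by omega)
      (mul_mem_steepDifferences (const_mem_steepDifferences hchoose) hΔ)
  · obtain rfl : p = i + 1 := heq.symm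
    have hone : (fun _ : G => ((i + 1).choose (i + 1) : R)) = 1 := by ext; simp
    simpa only [hone, one_mul, Nat.add_sub_cancel] using hΔ

theorem sum_zmod_eq_sum_range {M : Type*} [AddCommMonoid M] (n : ℕ) [NeZero n] (g : ZMod n → M) :
    ∑ c, g c = ∑ j ∈ range n, g j :=
  sum_nbij' ZMod.val (fun j => (j : ZMod n)) (by simp [ZMod.val_lt]) (by simp) (by simp)
    (fun _ hj => ZMod.val_cast_of_lt (mem_range.1 hj)) (by simp)

theorem le_valuation_sum_linearCombination {p : ℕ} [Fact p.Prime] {V : Type*} [AddCommGroup V]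
    [Module (ZMod p) V] (hv : ((p - 1 : ℕ) : ℕ∞) ≤ v p) {b D : ℕ} {F : V → R}
    (hF : F ∈ steepDifferences V v b) (w : Fin D → V) (x : V) :
    ((b + D * (p - 1) : ℕ) : ℕ∞) ≤ v (∑ c : Fin D → ZMod p, F (x + ∑ i, c i • w i)) := by
  induction D generalizing b F with
  | zero => simpa [mem_valuationGE] using apply_mem_of_mem_differencesIn hF x
  | succ D ih =>
    have hsplit : ∑ c : Fin (D + 1) → ZMod p, F (x + ∑ i, c i • w i) =
        ∑ c : Fin D → ZMod p, ∑ j ∈ range p, F (x + ∑ i, c i • w i.succ + j • w 0) := by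
      rw [← (Fin.consEquiv fun _ => ZMod p).sum_comp, Fintype.sum_prod_type, sum_comm]
      refine sum_congr rfl fun c _ => ?_
      rw [sum_zmod_eq_sum_range]
      refine sum_congr rfl fun j _ => congrArg F ?_
      simp [Fin.consEquiv, Fin.sum_univ_succ, Nat.cast_smul_eq_nsmul, add_left_comm, add_comm]
    rw [hsplit, add_mul, one_mul, add_comm (D * _), ← add_assoc]
    exact ih (sum_range_shift_mem_steepDifferences Fact.out hv hF (w 0)) fun i => w i.succ

theorem finrank_mul_le_valuation_sum_addChar {p : ℕ} [Fact p.Prime] {V A : Type*} [AddCommGroup V]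
    [Fintype V] [Module (ZMod p) V] [AddCommGroup A] (hv : ((p - 1 : ℕ) : ℕ∞) ≤ v p)
    (ψ : AddChar A R) {r : ℕ} (hψ : ∀ a, r ≤ v (ψ a - 1)) {h : V → A}
    (hh : FunctionalDegreeLE r h) :
    ((Module.finrank (ZMod p) V * (p - 1) : ℕ) : ℕ∞) ≤ v (∑ x, ψ (h x)) := by
  let basis := Module.finBasis (ZMod p) V
  have hF := addChar_comp_mem_steepDifferences ψ hψ hh
  rw [← basis.equivFun.symm.toEquiv.sum_comp]
  simpa [Module.Basis.equivFun_symm_apply] using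
    le_valuation_sum_linearCombination hv hF basis 0

end Valuation

section Counting

open Classical in
theorem natCard_eq_sum_addChar {R K X : Type*} [CommRing R] [IsDomain R] [CharZero R] [CommRing K]
    [Fintype K] [Fintype X] {ψ : AddChar K R} (hψ : ψ.IsPrimitive) (g : X → K) (L : K →+ K) :
    (Nat.card {z : X × K // g z.1 = L z.2} : R) =
      ∑ b : K with (AddChar.mulShift ψ b).compAddMonoidHom L = 0, ∑ x, ψ (b * g x) := by
  have hK : (Fintype.card K : R) ≠ 0 := Nat.cast_ne_zero.2 Fintype.card_ne_zero
  let χ (b : K) : AddChar K R := (AddChar.mulShift ψ b).compAddMonoidHom L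
  refine mul_left_cancel₀ hK ?_
  calc (Fintype.card K : R) * (Nat.card {z : X × K // g z.1 = L z.2} : R)
      = ∑ z : X × K, ∑ b, ψ (b * (g z.1 - L z.2)) := by
        simp_rw [AddChar.sum_mulShift _ hψ, sub_eq_zero]
        simp [Nat.card_eq_fintype_card, Fintype.card_subtype, ← sum_filter, mul_comm]
    _ = ∑ b, (∑ x, ψ (b * g x)) * ∑ y, χ b (-y) := by
        rw [sum_comm]
        refine sum_congr rfl fun b _ => ?_
        rw [sum_mul_sum, Fintype.sum_prod_type]
        refine sum_congr rfl fun x _ => sum_congr rfl fun y _ => ?_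
        simp only [χ, sub_eq_add_neg, mul_add, AddChar.map_add_eq_mul,
          AddChar.compAddMonoidHom_apply, AddChar.mulShift_apply, map_neg]
    _ = ∑ b, (∑ x, ψ (b * g x)) * if χ b = 0 then (Fintype.card K : R) else 0 := by
        refine sum_congr rfl fun b _ => ?_
        rw [← AddChar.sum_eq_ite, ← Equiv.sum_comp (Equiv.neg K) (χ b ·)]
        rfl
    _ = (Fintype.card K : R) * ∑ b with χ b = 0, ∑ x, ψ (b * g x) := by
        rw [sum_filter, mul_sum]
        exact sum_congr rfl fun b _ => by split_ifs <;> simp [mul_comm]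

end Counting

section Cyclotomic

theorem emultiplicity_natCast_of_associated {R : Type*} [CommRing R] [IsDomain R] {π : R}
    (hπ : Prime π) {p n : ℕ} (hp : p.Prime) (hn : n ≠ 0) (hassoc : Associated (π ^ n) (p : R))
    (N : ℕ) : emultiplicity π (N : R) = n * emultiplicity p N := by
  have hπp : emultiplicity π (p : R) = n := by
    rw [← emultiplicity_eq_of_associated_right hassoc, emultiplicity_pow_self_of_prime hπ]
  rcases eq_or_ne N 0 with rfl | hN
  · simp [hn]
  obtain ⟨r, u, hpu, rfl⟩ := Nat.exists_eq_pow_mul_and_not_dvd hN p hp.ne_one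
  have hπu : ¬π ∣ (u : R) := fun hdvd => by
    have hcop : IsCoprime (p : R) u := (hp.coprime_iff_not_dvd.2 hpu).cast
    exact hπ.not_isUnit (hcop.isUnit_of_dvd' ((dvd_pow_self π hn).trans hassoc.dvd) hdvd)
  simp [emultiplicity_mul hπ, emultiplicity_mul hp.prime, emultiplicity_pow hπ, hπp,
    emultiplicity_pow_self_of_prime hp.prime, emultiplicity_eq_zero.2 hπu,
    emultiplicity_eq_zero.2 hpu, mul_comm]

open NumberField in
theorem exists_cyclotomic_addChar (p : ℕ) [Fact p.Prime] (K : Type*) [Field K] [Finite K]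
    [CharP K p] :
    ∃ π : 𝓞 (CyclotomicField p ℚ), Prime π ∧
      Associated (π ^ (p - 1)) (p : 𝓞 (CyclotomicField p ℚ)) ∧
      ∃ ψ : AddChar K (𝓞 (CyclotomicField p ℚ)), ψ.IsPrimitive ∧ ∀ a, π ∣ ψ a - 1 := by
  have : IsCyclotomicExtension {p} ℚ (CyclotomicField p ℚ) :=
    CyclotomicField.isCyclotomicExtension p ℚ
  have hζ := IsCyclotomicExtension.zeta_spec p ℚ (CyclotomicField p ℚ)
  have hint := hζ.toInteger_isPrimitiveRoot
  let _ : Algebra (ZMod p) K := ZMod.algebra K p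
  let ψ := (AddChar.zmodChar p hint.pow_eq_one).compAddMonoidHom
    (Algebra.trace (ZMod p) K).toAddMonoidHom
  have hψ (a : K) : ψ a = hζ.toInteger ^ (Algebra.trace (ZMod p) K a).val := rfl
  refine ⟨hζ.toInteger - 1, hζ.zeta_sub_one_prime',
    IsCyclotomicExtension.Rat.associated_zeta_sub_one_pow_prime p hζ, ψ,
    AddChar.IsPrimitive.of_ne_one (AddChar.ne_one_iff.2 ?_), fun a => ?_⟩
  · obtain ⟨a, ha⟩ := Algebra.trace_surjective (ZMod p) K 1
    refine ⟨a, ?_⟩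
    rw [hψ, ha, ZMod.val_one, pow_one]
    exact hint.ne_one (Fact.out : p.Prime).one_lt
  · rw [hψ]
    exact sub_one_dvd_pow_sub_one _ _

end Cyclotomic

section Divisibility

theorem finrank_mul_le_mul_emultiplicity_sum_addChar {R : Type*} [CommRing R] [IsDomain R] {π : R}
    (hπ : Prime π) {p : ℕ} [Fact p.Prime] (hπp : π ^ (p - 1) ∣ (p : R)) {V A ι : Type*}
    [AddCommGroup V] [Fintype V] [Module (ZMod p) V] [AddCommGroup A] (ψ : AddChar A R)
    (hψ : ∀ a, π ∣ ψ a - 1) {r : ℕ} (hr : 0 < r) {s : Finset ι} {h : ι → V → A}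
    (hh : ∀ i ∈ s, FunctionalDegreeLE r (h i)) :
    ((Module.finrank (ZMod p) V * (p - 1) : ℕ) : ℕ∞) ≤
      r * emultiplicity π (∑ i ∈ s, ∑ x, ψ (h i x)) := by
  have hr' : (1 : ℕ∞) ≤ r := Nat.one_le_cast.2 hr
  -- Scaling by `r` makes the valuations of the values of `ψ - 1` reach the degree bound.
  let v : AddValuation R ℕ∞ := (multiplicity_addValuation hπ).map (AddMonoidHom.mulLeft (r : ℕ∞))
    (ENat.mul_top (Nat.cast_ne_zero.2 hr.ne')) fun _ _ hab => mul_le_mul_right hab _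
  have hvp : ((p - 1 : ℕ) : ℕ∞) ≤ v p :=
    (le_emultiplicity_of_pow_dvd hπp).trans (le_mul_of_one_le_left' hr')
  have hvψ (a : A) : (r : ℕ∞) ≤ v (ψ a - 1) :=
    le_mul_of_one_le_right' (le_emultiplicity_of_pow_dvd (by simpa using hψ a))
  exact v.map_le_sum fun i hi => finrank_mul_le_valuation_sum_addChar hvp ψ hvψ (hh i hi)

open NumberField in
theorem finrank_le_mul_emultiplicity_natCard {p : ℕ} [Fact p.Prime] {K V : Type*} [Field K]
    [Finite K] [CharP K p] [AddCommGroup V] [Finite V] [Module (ZMod p) V] {r : ℕ} (hr : 0 < r)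
    {g : V → K} (hg : FunctionalDegreeLE r g) (L : K →+ K) :
    (Module.finrank (ZMod p) V : ℕ∞) ≤
      r * emultiplicity p (Nat.card {z : V × K // g z.1 = L z.2}) := by
  have := Fintype.ofFinite K
  have := Fintype.ofFinite V
  obtain ⟨π, hπ, hassoc, ψ, hψ, hψπ⟩ := exists_cyclotomic_addChar p K
  have hp : p - 1 ≠ 0 := Nat.sub_ne_zero_of_lt (Fact.out : p.Prime).one_lt
  have hπN : ((Module.finrank (ZMod p) V * (p - 1) : ℕ) : ℕ∞) ≤
      r * emultiplicity π (Nat.card {z : V × K // g z.1 = L z.2} : 𝓞 (CyclotomicField p ℚ)) := by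
    rw [natCard_eq_sum_addChar hψ g L]
    exact finrank_mul_le_mul_emultiplicity_sum_addChar hπ hassoc.dvd ψ hψπ hr
      fun b _ => hg.map (AddMonoidHom.mulLeft b)
  rw [emultiplicity_natCast_of_associated hπ Fact.out hp hassoc, mul_left_comm,
    Nat.cast_mul, mul_comm] at hπN
  exact (ENat.mul_le_mul_left_iff (Nat.cast_ne_zero.2 hp) (ENat.natCast_ne_top _)).1 hπN

theorem ceil_div_le_of_le_mul {D W : ℕ} (hW : 0 < W) {a : ℕ∞} (h : (D : ℕ∞) ≤ W * a) :
    (⌈(D : ℚ) / W⌉₊ : ℕ∞) ≤ a := by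
  cases a with
  | top => exact le_top
  | coe a =>
    have hDW : (D : ℚ) ≤ a * W := by
      rw [mul_comm]
      exact_mod_cast h
    exact Nat.cast_le.2 (Nat.ceil_le.2 ((div_le_iff₀ (Nat.cast_pos.2 hW)).2 hDW))

end Divisibility

section FiniteField

theorem charP_of_natCard_eq_prime_pow {K : Type*} [CommRing K] [IsDomain K] [Finite K] {p n : ℕ}
    [Fact p.Prime] (hK : Nat.card K = p ^ n) : CharP K p := by
  have := Fintype.ofFinite K
  exact charP_of_card_eq_prime_pow (Nat.card_eq_fintype_card.symm.trans hK)

theorem finrank_pi_of_natCard_eq_pow {p : ℕ} [Fact p.Prime] {K : Type*} [Field K] [Finite K]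
    [Algebra (ZMod p) K] {n : ℕ} (hK : Nat.card K = p ^ n) (k : ℕ) :
    Module.finrank (ZMod p) (Fin k → K) = n * k := by
  have hn : Module.finrank (ZMod p) K = n := by
    refine Nat.pow_right_injective (Fact.out : p.Prime).two_le ?_
    simpa [hK] using (Module.natCard_eq_pow_finrank (K := ZMod p) (V := K)).symm
  simp [Module.finrank_pi_fintype, hn, mul_comm]

/-- The Artin–Schreier map `y ↦ y ^ q - y` with `q = p ^ e`, as an additive endomorphism. -/
def artinSchreier (K : Type*) [CommRing K] (p e : ℕ) [ExpChar K p] : K →+ K :=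
  (iterateFrobenius K p e).toAddMonoidHom - AddMonoidHom.id K

theorem artinSchreier_apply {K : Type*} [CommRing K] {p e : ℕ} [ExpChar K p] (y : K) :
    artinSchreier K p e y = y ^ p ^ e - y := by
  simp [artinSchreier, iterateFrobenius_def]

end FiniteField

end ArtinSchreierCount

theorem mainTheorem8_general {p n k : ℕ} (hp : p.Prime) {K : Type*} [Field K] [Finite K]
    (hK : Nat.card K = p ^ n) (f : MvPolynomial (Fin k) K) (hf : 0 < f.totalDegree) (L : K →+ K) :
    (⌈((n * k : ℕ) : ℚ) / (ArtinSchreierCount.maxDigitSum p (p ^ n) k f.totalDegree : ℚ)⌉₊ : ℕ∞) ≤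
      emultiplicity p
        (Nat.card {z : (Fin k → K) × K // MvPolynomial.eval z.1 f = L z.2}) := by
  have : Fact p.Prime := ⟨hp⟩
  have := ArtinSchreierCount.charP_of_natCard_eq_prime_pow hK
  let _ : Algebra (ZMod p) K := ZMod.algebra K p
  have hk : 0 < k := Nat.pos_of_ne_zero fun hk => by
    subst hk
    rw [MvPolynomial.eq_C_of_isEmpty f, MvPolynomial.totalDegree_C] at hf
    exact hf.false
  have hW := ArtinSchreierCount.maxDigitSum_pos hp.one_lt (Finite.one_lt_card (α := K)) hk hf
  rw [← hK, ← ArtinSchreierCount.finrank_pi_of_natCard_eq_pow hK k]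
  exact ArtinSchreierCount.ceil_div_le_of_le_mul hW
    (ArtinSchreierCount.finrank_le_mul_emultiplicity_natCard hW
      (ArtinSchreierCount.functionalDegreeLE_eval p f) L)

theorem mainTheorem8 (p e q m k d : ℕ) (hp : p.Prime) (hq : q = p ^ e)
    (K : Type*) [Field K] [Finite K] (hK : Nat.card K = q ^ m)
    (f : MvPolynomial (Fin k) K) (hd : 1 ≤ d) (hf : f.totalDegree = d) :
    ((⌈((e * m * k : ℕ) : ℚ) / (ArtinSchreierCount.maxDigitSum p (q ^ m) k d : ℚ)⌉₊ : ℕ) : ℕ∞) ≤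
      emultiplicity p (ArtinSchreierCount.solutionCount f q) := by
  subst hq hf
  rw [← pow_mul] at hK ⊢
  have : Fact p.Prime := ⟨hp⟩
  have := ArtinSchreierCount.charP_of_natCard_eq_prime_pow hK
  simpa only [ArtinSchreierCount.solutionCount, ArtinSchreierCount.artinSchreier_apply] using
    mainTheorem8_general hp hK f hd (ArtinSchreierCount.artinSchreier K p e)
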